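/- Let $m\ge 1$, $[m]=\{1,\dots,m\}$, let $\mathbf k$ be a field of arbitrary characteristic, and let $f:2^{[m]}\to\mathbb Z/2\mathbb Z$ be a function. Write $\mathrm{supp}(g)=g^{-1}(1)$ for $g:2^{[m]}\to\mathbb Z/2\mathbb Z$, and define the Möbius transform of $f$ by $\mathcal M(f)(a)=\sum_{b\subseteq a}f(b)$ for $a\subseteq[m]$. Suppose that $f$ is nice with $K_f=\mathrm{supp}(f)$ an abstract simplicial complex on $[m]$, i.e. every subset (including $\emptyset$) of a member of $K_f$ belongs to $K_f$, and $\bigcup_{a\in K_f}a=[m]$. Let $\mathbf k(K_f)=\mathbf k[v_1,\dots,v_m]/\langle \prod_{i\in\tau}v_i : \tau\subseteq[m],\ \tau\notin K_f\rangle$ be the Stanley–Reisner face ring with its $\mathbb N^m$-grading. Then $\mathbf k(K_f)$ has an $\mathbb N^m$-graded minimal free resolution of finite length over $\mathbf k[\mathbf v]=\mathbf k[v_1,\dots,v_m]$, $$0\leftarrow \mathbf k(K_f)\leftarrow F_0\leftarrow F_1\leftarrow\cdots\leftarrow F_h\leftarrow 0,\qquad F_i=\bigoplus_{\mathbf a\in\mathbb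 N^m}\mathbf k[\mathbf v](-\mathbf a)^{\beta_{i,\mathbf a}},$$ and for every such resolution, with $h$ its length and $\beta_{i,a}^{\mathbf k(K_f)}:=\beta_{i,\mathbf a}$ where $\mathbf a\in\{0,1\}^m$ is the indicator vector of $a\subseteq[m]$ (the Betti numbers of $\mathbf k(K_f)$), $$|\mathrm{supp}(\mathcal M(f))|\le\sum_{i=0}^{h}\sum_{a\in 2^{[m]}}\beta_{i,a}^{\mathbf k(K_f)}.$$ -/

import Mathlib

open MvPolynomial

noncomputable section

namespace FaceRing

/-- The support `f⁻¹(1)` of a `ℤ/2`-valued function on the power set of `[m]`. -/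
def supp {m : ℕ} (f : Finset (Fin m) → ZMod 2) : Finset (Finset (Fin m)) :=
  Finset.univ.filter fun a => f a = 1

/-- `K` is closed under passing to subsets (the empty set counts as a simplex). -/
def IsSimplicialComplex {m : ℕ} (K : Finset (Finset (Fin m))) : Prop :=
  ∀ a ∈ K, ∀ b, b ⊆ a → b ∈ K

/-- The vertex set `⋃_{a ∈ K} a`. -/
def vertexSet {m : ℕ} (K : Finset (Finset (Fin m))) : Finset (Fin m) :=
  K.biUnion id

/-- `f` is nice if its support is an abstract simplicial complex. -/
def IsNice {m : ℕ} (f : Finset (Fin m) → ZMod 2) : Prop :=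
  IsSimplicialComplex (supp f)

/-- The `ℤ/2`-valued Möbius transform. -/
def mobius {m : ℕ} (f : Finset (Fin m) → ZMod 2) : Finset (Fin m) → ZMod 2 :=
  fun a => ∑ b ∈ a.powerset, f b

/-- The exponent vector in `{0,1}^m` with entry `1` exactly at the elements of `a`. -/
def squarefreeVector {m : ℕ} (a : Finset (Fin m)) : Fin m →₀ ℕ :=
  ∑ i ∈ a, Finsupp.single i 1

/-- The Stanley–Reisner ideal, generated by the squarefree monomials of the non-faces of `K`. -/
def stanleyReisnerIdeal (k : Type*) [Field k] {m : ℕ} (K : Finset (Finset (Fin m))) :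
    Ideal (MvPolynomial (Fin m) k) :=
  Ideal.span {p | ∃ τ : Finset (Fin m), τ ∉ K ∧ p = ∏ i ∈ τ, X i}

/-- The Stanley–Reisner face ring. -/
abbrev faceRing (k : Type*) [Field k] {m : ℕ} (K : Finset (Finset (Fin m))) : Type _ :=
  MvPolynomial (Fin m) k ⧸ stanleyReisnerIdeal k K

/-- The component of degree `b` of the face ring, spanned by the class of the monomial `v^b`. -/
def faceRingDegree (k : Type*) [Field k] {m : ℕ} (K : Finset (Finset (Fin m)))
    (b : Fin m →₀ ℕ) : Submodule k (faceRing k K) :=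
  Submodule.span k {Ideal.Quotient.mk (stanleyReisnerIdeal k K) (monomial b 1)}

/-- The component of degree `b` of the graded free module `⨁_j k[v](-deg j)`: the `j`-th
coordinate is a multiple of the monomial `v^c` with `deg j + c = b` (zero if there is no such
`c`). -/
def freeDegree (k : Type*) [Field k] {m r : ℕ} (deg : Fin r → (Fin m →₀ ℕ))
    (b : Fin m →₀ ℕ) : Submodule k (Fin r → MvPolynomial (Fin m) k) :=
  Submodule.pi Set.univ fun j => restrictSupport k {c | deg j + c = b}

/-- An `ℕ^m`-graded minimal free resolution
`0 ← k(K) ← F₀ ← F₁ ← ⋯ ← F_h ← 0` of finite length `h`, where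
`F i = ⨁_{j < rank i} k[v](-deg i j)`. -/
structure MinimalFreeResolution (k : Type*) [Field k] {m : ℕ}
    (K : Finset (Finset (Fin m))) where
  /-- the length `h` -/
  length : ℕ
  /-- the rank of `F i` -/
  rank : ℕ → ℕ
  /-- the degree of the `j`-th basis element of `F i` -/
  deg : ∀ i, Fin (rank i) → (Fin m →₀ ℕ)
  /-- the augmentation `F₀ → k(K)` -/
  aug : (Fin (rank 0) → MvPolynomial (Fin m) k) →ₗ[MvPolynomial (Fin m) k] faceRing k K
  /-- the differential `F (i + 1) → F i` -/
  d : ∀ i, (Fin (rank (i + 1)) → MvPolynomial (Fin m) k) →ₗ[MvPolynomial (Fin m) k]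
    (Fin (rank i) → MvPolynomial (Fin m) k)
  rank_length : rank length ≠ 0
  rank_eq_zero : ∀ i, length < i → rank i = 0
  aug_degree : ∀ b, ∀ x ∈ freeDegree k (deg 0) b, aug x ∈ faceRingDegree k K b
  d_degree : ∀ i b, ∀ x ∈ freeDegree k (deg (i + 1)) b, d i x ∈ freeDegree k (deg i) b
  aug_surjective : Function.Surjective aug
  exact_zero : Function.Exact (d 0) aug
  exact_succ : ∀ i, Function.Exact (d (i + 1)) (d i)
  /-- minimality: the image of each differential lies in `⟨v₁, …, v_m⟩ F i` -/
  minimal : ∀ i x j, constantCoeff (d i x j) = 0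

/-- The Betti number `β_{i,b}`: the multiplicity of `k[v](-b)` as a summand of `F i`. -/
def MinimalFreeResolution.betti {k : Type*} [Field k] {m : ℕ} {K : Finset (Finset (Fin m))}
    (F : MinimalFreeResolution k K) (i : ℕ) (b : Fin m →₀ ℕ) : ℕ :=
  (Finset.univ.filter fun j => F.deg i j = b).card

end FaceRing

end

/-!
In degree `b` an `ℕ^m`-graded free resolution of `k(K)` is an exact complex of vector spaces: a
summand `k[v](-c)` contributes dimension `1` if `c ≤ b` and `0` otherwise, and `k(K)` contributes
`1` exactly when the support of `b` is a face of `K`. For the squarefree `b` supported on `a ⊆ [m]`,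
the Euler characteristic therefore expresses the indicator function of `K` at `a` as the alternating
sum of the Betti numbers `β_{i,c}` with `c ⊆ a`. Modulo `2` the signs disappear, and `f` is the
Möbius transform of `a ↦ ∑ᵢ β_{i,a}`. As the Möbius transform is an involution modulo `2`,
`M(f)(a) ≡ ∑ᵢ β_{i,a}`, so each `a` in the support of `M(f)` has a nonzero Betti number.

For existence, all syzygy modules of `k(K)` are generated in squarefree degrees: a homogeneous
relation among generators of squarefree degrees whose own degree is at least `2` at `i` can be
divided by `v_i`. Minimality strictly raises the total degree of the generators from one step to the
next, while squarefree degrees have total degree at most `m`, so the resolution is finite.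
-/

noncomputable section

namespace FaceRing

section GradedMaps

variable {R M N P ι : Type*} [Ring R] [AddCommGroup M] [Module R M] [AddCommGroup N] [Module R N]
  [AddCommGroup P] [Module R P] {A : ι → Submodule R M} {B : ι → Submodule R N}
  {C : ι → Submodule R P} {f : M →ₗ[R] N} {g : N →ₗ[R] P}

/-- The range of `f` is the sum of `f(A b) ≤ B b` and of a submodule disjoint from `B b`, so the
modular law applies. -/
lemma map_eq_range_inf (hA : ⨆ b, A b = ⊤) (hB : iSupIndep B) (hf : ∀ b, ∀ x ∈ A b, f x ∈ B b)
    (b : ι) : (A b).map f = LinearMap.range f ⊓ B b := by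
  have hfB : ∀ c, (A c).map f ≤ B c := fun c => Submodule.map_le_iff_le_comap.2 (hf c)
  have hrest : (⨆ (c) (_ : c ≠ b), (A c).map f) ⊓ B b = ⊥ :=
    ((hB b).symm.mono_left (iSup₂_mono fun c _ => hfB c)).eq_bot
  rw [LinearMap.range_eq_map, ← hA, Submodule.map_iSup, iSup_split_single _ b,
    sup_inf_assoc_of_le _ (hfB b), hrest, sup_bot_eq]

lemma exact_restrict (hA : ⨆ b, A b = ⊤) (hB : iSupIndep B) (hf : ∀ b, ∀ x ∈ A b, f x ∈ B b)
    (hg : ∀ b, ∀ x ∈ B b, g x ∈ C b) (hfg : Function.Exact f g) (b : ι) :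
    Function.Exact (f.restrict (hf b)) (g.restrict (hg b)) := by
  rintro ⟨y, hy⟩
  have hmem : y ∈ (A b).map f ↔ g y = 0 := by
    rw [map_eq_range_inf hA hB hf, hfg y, Submodule.mem_inf, and_iff_left hy, LinearMap.mem_range,
      Set.mem_range]
  simp only [Subtype.ext_iff, LinearMap.coe_restrict_apply, ZeroMemClass.coe_zero, ← hmem,
    Submodule.mem_map, Set.mem_range, Subtype.exists, exists_prop]

lemma surjective_restrict (hA : ⨆ b, A b = ⊤) (hB : iSupIndep B)
    (hf : ∀ b, ∀ x ∈ A b, f x ∈ B b) (hsurj : Function.Surjective f) (b : ι) :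
    Function.Surjective (f.restrict (hf b)) := by
  rintro ⟨y, hy⟩
  have hmem : y ∈ (A b).map f := by
    rw [map_eq_range_inf hA hB hf]
    exact ⟨hsurj y, hy⟩
  obtain ⟨x, hx, rfl⟩ := hmem
  exact ⟨⟨x, hx⟩, rfl⟩

lemma ker_le_iSup_ker_inf (hA : ⨆ b, A b = ⊤) (hB : iSupIndep B)
    (hf : ∀ b, ∀ x ∈ A b, f x ∈ B b) : LinearMap.ker f ≤ ⨆ b, LinearMap.ker f ⊓ A b := by
  intro x hx
  obtain ⟨u, hu, rfl⟩ := (Submodule.mem_iSup_iff_exists_finsupp A x).1 (hA ▸ Submodule.mem_top)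
  have hsum : ∑ b ∈ u.support, f (u b) = 0 := by rw [← map_sum]; exact hx
  have hker := (iSupIndep_iff_finsetSum_eq_zero_imp_eq_zero B).1 hB u.support (fun b => f (u b))
    (fun b _ => hf b _ (hu b)) hsum
  exact Submodule.sum_mem _ fun b hb => Submodule.mem_iSup_of_mem b ⟨hker b hb, hu b⟩

end GradedMaps

section EulerCharacteristic

variable {K W : Type*} [DivisionRing K] [AddCommGroup W] [Module K W] {V : ℕ → Type*}
  [∀ i, AddCommGroup (V i)] [∀ i, Module K (V i)] [∀ i, FiniteDimensional K (V i)]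
  {d : ∀ i, V (i + 1) →ₗ[K] V i} {ε : V 0 →ₗ[K] W}

lemma sum_neg_one_pow_finrank_eq_add_range (hε : Function.Surjective ε)
    (h0 : Function.Exact (d 0) ε) (hd : ∀ i, Function.Exact (d (i + 1)) (d i)) (n : ℕ) :
    ∑ i ∈ Finset.range (n + 1), (-1 : ℤ) ^ i * Module.finrank K (V i) =
      Module.finrank K W + (-1) ^ n * Module.finrank K (LinearMap.range (d n)) := by
  induction n with
  | zero =>
    have hrank := ε.finrank_range_add_finrank_ker
    rw [LinearMap.range_eq_top.2 hε, finrank_top, h0.linearMap_ker_eq] at hrank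
    simp [← hrank]
  | succ n ih =>
    have hrank := (d n).finrank_range_add_finrank_ker
    rw [(hd n).linearMap_ker_eq] at hrank
    rw [Finset.sum_range_succ, ih, ← hrank]
    push_cast
    ring

theorem sum_neg_one_pow_finrank_of_exact (hε : Function.Surjective ε)
    (h0 : Function.Exact (d 0) ε) (hd : ∀ i, Function.Exact (d (i + 1)) (d i)) (n : ℕ)
    [Subsingleton (V (n + 1))] :
    ∑ i ∈ Finset.range (n + 1), (-1 : ℤ) ^ i * Module.finrank K (V i) = Module.finrank K W := by
  rw [sum_neg_one_pow_finrank_eq_add_range hε h0 hd, Subsingleton.elim (d n) 0,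
    LinearMap.range_zero, finrank_bot, Nat.cast_zero, mul_zero, add_zero]

end EulerCharacteristic

section Irredundant

lemma exists_irredundant_fin_span_eq {R M : Type*} [Semiring R] [AddCommMonoid M] [Module R M]
    {S : Set M} (hS : (Submodule.span R S).FG) :
    ∃ (n : ℕ) (g : Fin n → M), (∀ j, g j ∈ S) ∧
      Submodule.span R (Set.range g) = Submodule.span R S ∧
      ∀ j, g j ∉ Submodule.span R (g '' {j}ᶜ) := by
  classical
  have hex : ∃ (n : ℕ) (g : Fin n → M), (∀ j, g j ∈ S) ∧
      Submodule.span R (Set.range g) = Submodule.span R S := by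
    obtain ⟨G, hGS, hG⟩ := (Submodule.fg_span_iff_fg_span_finset_subset S).1 hS
    refine ⟨G.card, fun j => G.equivFin.symm j, fun j => hGS (G.equivFin.symm j).2, ?_⟩
    rw [hG, ← Function.comp_def, G.equivFin.symm.surjective.range_comp, Subtype.range_coe]
  obtain ⟨n, ⟨g, hgS, hspan⟩, hmin⟩ : ∃ n, (∃ g : Fin n → M, (∀ j, g j ∈ S) ∧
      Submodule.span R (Set.range g) = Submodule.span R S) ∧ ∀ l < n, ¬ ∃ g : Fin l → M,
        (∀ j, g j ∈ S) ∧ Submodule.span R (Set.range g) = Submodule.span R S :=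
    ⟨Nat.find hex, Nat.find_spec hex, fun _ => Nat.find_min hex⟩
  refine ⟨n, g, hgS, hspan, fun j hj => ?_⟩
  obtain _ | n := n
  · exact j.elim0
  have hrange : Set.range g = insert (g j) (g '' {j}ᶜ) := by
    rw [← Set.image_insert_eq, Set.insert_eq, Set.union_compl_self, Set.image_univ]
  refine hmin n n.lt_succ_self ⟨g ∘ j.succAbove, fun i => hgS _, ?_⟩
  rw [Set.range_comp, Fin.range_succAbove, ← hspan, hrange, Submodule.span_insert_eq_span hj]

lemma not_isUnit_of_sum_smul_eq_zero {R M ι : Type*} [Ring R] [AddCommGroup M] [Module R M]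
    [Fintype ι] {g : ι → M} {x : ι → R} (hx : ∑ i, x i • g i = 0) {j : ι}
    (hj : g j ∉ Submodule.span R (g '' {j}ᶜ)) :
    ¬ IsUnit (x j) := by
  classical
  intro hunit
  rw [← Finset.add_sum_erase _ _ (Finset.mem_univ j)] at hx
  have hmem : x j • g j ∈ Submodule.span R (g '' {j}ᶜ) := by
    rw [eq_neg_of_add_eq_zero_left hx]
    exact Submodule.neg_mem _ (Submodule.sum_mem _ fun i hi => Submodule.smul_mem _ _
      (Submodule.subset_span ⟨i, Finset.ne_of_mem_erase hi, rfl⟩))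
  exact hj ((Submodule.smul_mem_iff_of_isUnit _ hunit).1 hmem)

end Irredundant

section RestrictSupport

variable {R σ : Type*} [CommRing R]

lemma finrank_restrictSupport_add_eq [Nontrivial R] (a b : σ →₀ ℕ) :
    Module.finrank R (restrictSupport R {c | a + c = b}) = if a ≤ b then 1 else 0 := by
  rw [Module.finrank_eq_nat_card_basis (basisRestrictSupport R _)]
  split_ifs with h
  · have hsingleton : {c | a + c = b} = {b - a} := by
      ext c
      rw [Set.mem_ofPred_eq, Set.mem_singleton_iff, eq_tsub_iff_add_eq_of_le h, add_comm]
    rw [hsingleton, Nat.card_unique]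
  · have hempty : {c | a + c = b} = ∅ :=
      Set.eq_empty_of_forall_notMem fun c hc => h (hc ▸ le_self_add)
    rw [hempty, Nat.card_of_isEmpty]

instance finite_restrictSupport_add_eq (a b : σ →₀ ℕ) :
    Module.Finite R (restrictSupport R {c | a + c = b}) := by
  have : Finite {c | a + c = b} :=
    (Set.subsingleton_of_forall_eq (b - a) fun c hc => eq_tsub_of_add_eq
      ((add_comm c a).trans hc)).finite
  exact Module.Finite.of_basis (basisRestrictSupport R _)

end RestrictSupport

section FreeModules

variable {k : Type*} [Field k] {m r : ℕ} {deg : Fin r → (Fin m →₀ ℕ)} {b : Fin m →₀ ℕ}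

lemma mem_freeDegree {x : Fin r → MvPolynomial (Fin m) k} :
    x ∈ freeDegree k deg b ↔ ∀ j c, coeff c (x j) ≠ 0 → deg j + c = b := by
  simp only [freeDegree, Submodule.mem_pi, Set.mem_univ, true_imp_iff, mem_restrictSupport_iff,
    Set.subset_def, Finset.mem_coe, mem_support_iff, Set.mem_ofPred_eq]

lemma iSup_freeDegree (deg : Fin r → (Fin m →₀ ℕ)) : ⨆ b, freeDegree k deg b = ⊤ := by
  classical
  rw [eq_top_iff, ← LinearMap.iSup_range_single k]
  refine iSup_le fun j => ?_
  rintro _ ⟨p, rfl⟩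
  induction p using MvPolynomial.induction_on' with
  | monomial c u =>
    refine Submodule.mem_iSup_of_mem (deg j + c) fun l _ => ?_
    obtain rfl | hl := eq_or_ne l j
    · simp
    · simp [hl]
  | add p q hp hq => rw [map_add]; exact Submodule.add_mem _ hp hq

lemma iSupIndep_freeDegree (deg : Fin r → (Fin m →₀ ℕ)) : iSupIndep (freeDegree k deg) := by
  intro b
  have hle : ⨆ (c) (_ : c ≠ b), freeDegree k deg c ≤
      Submodule.pi Set.univ fun j => restrictSupport k {e | deg j + e ≠ b} :=
    iSup₂_le fun c hc => Submodule.pi_mono fun j _ =>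
      restrictSupport_mono k fun e (he : deg j + e = c) => he.trans_ne hc
  refine (Submodule.disjoint_def.2 fun x hx hx' => ?_).mono_right hle
  ext j e
  by_contra he
  exact hx' j trivial (mem_support_iff.2 he) (mem_freeDegree.1 hx j e he)

/-- The component of degree `b` of `⨁_j k[v](-deg j)` as the product of the components of degree
`b` of its summands. -/
def freeDegreeEquivPi (k : Type*) [Field k] (deg : Fin r → (Fin m →₀ ℕ)) (b : Fin m →₀ ℕ) :
    freeDegree k deg b ≃ₗ[k] ∀ j, restrictSupport k {c | deg j + c = b} where
  toFun x j := ⟨x.1 j, x.2 j trivial⟩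
  map_add' _ _ := rfl
  map_smul' _ _ := rfl
  invFun u := ⟨fun j => u j, fun j _ => (u j).2⟩
  left_inv _ := rfl
  right_inv _ := rfl

instance finite_freeDegree (deg : Fin r → (Fin m →₀ ℕ)) (b : Fin m →₀ ℕ) :
    Module.Finite k (freeDegree k deg b) :=
  Module.Finite.equiv (freeDegreeEquivPi k deg b).symm

lemma finrank_freeDegree (deg : Fin r → (Fin m →₀ ℕ)) (b : Fin m →₀ ℕ) :
    Module.finrank k (freeDegree k deg b) = (Finset.univ.filter fun j => deg j ≤ b).card := by
  classical
  simp only [(freeDegreeEquivPi k deg b).finrank_eq, Module.finrank_pi_fintype,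
    finrank_restrictSupport_add_eq, Finset.card_filter]

lemma smul_mem_freeDegree {a : Fin m →₀ ℕ} {p : MvPolynomial (Fin m) k}
    (hp : ∀ c, coeff c p ≠ 0 → a + c = b) {x : Fin r → MvPolynomial (Fin m) k}
    (hx : x ∈ freeDegree k deg a) : p • x ∈ freeDegree k deg b := by
  classical
  rw [mem_freeDegree] at hx ⊢
  intro j c hc
  rw [Pi.smul_apply, smul_eq_mul, coeff_mul] at hc
  obtain ⟨⟨u, v⟩, huv, hne⟩ := Finset.exists_ne_zero_of_sum_ne_zero hc
  obtain rfl : u + v = c := Finset.HasAntidiagonal.mem_antidiagonal.1 huv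
  rw [← hp u (left_ne_zero_of_mul hne), ← hx j v (right_ne_zero_of_mul hne), add_assoc,
    add_comm u v]

lemma linearCombination_mem_freeDegree {s : ℕ} {deg' : Fin s → (Fin m →₀ ℕ)}
    {g : Fin s → Fin r → MvPolynomial (Fin m) k} (hg : ∀ j, g j ∈ freeDegree k deg (deg' j))
    {x : Fin s → MvPolynomial (Fin m) k} (hx : x ∈ freeDegree k deg' b) :
    Fintype.linearCombination (MvPolynomial (Fin m) k) g x ∈ freeDegree k deg b := by
  rw [Fintype.linearCombination_apply]
  exact Submodule.sum_mem _ fun j _ => smul_mem_freeDegree (mem_freeDegree.1 hx j) (hg j)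

lemma eq_C_of_mem_freeDegree {x : Fin r → MvPolynomial (Fin m) k} (hx : x ∈ freeDegree k deg b)
    {j : Fin r} (hj : constantCoeff (x j) ≠ 0) : x j = C (constantCoeff (x j)) := by
  classical
  have hb : deg j = b := by simpa using mem_freeDegree.1 hx j 0 hj
  ext c
  rw [coeff_C]
  split_ifs with h
  · rw [← h, constantCoeff_eq]
  · by_contra hc
    exact h (by simpa [← hb, eq_comm] using mem_freeDegree.1 hx j c hc)

lemma exists_X_smul_eq (hdeg : ∀ j i, deg j i ≤ 1) {i : Fin m} (hi : 2 ≤ b i)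
    {x : Fin r → MvPolynomial (Fin m) k} (hx : x ∈ freeDegree k deg b) :
    ∃ y ∈ freeDegree k deg (b - Finsupp.single i 1), (X i : MvPolynomial (Fin m) k) • y = x := by
  have hdvd : ∀ j, X i ∣ x j := fun j => X_dvd_iff_modMonomial_eq_zero.2 <| by
    ext c
    by_cases hc : Finsupp.single i 1 ≤ c
    · rw [coeff_modMonomial_of_le _ hc, coeff_zero]
    rw [coeff_modMonomial_of_not_le _ hc, coeff_zero]
    by_contra hne
    have hsum := DFunLike.congr_fun (mem_freeDegree.1 hx j c hne) i
    have hji := hdeg j i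
    rw [Finsupp.single_le_iff] at hc
    rw [Finsupp.add_apply] at hsum
    omega
  choose y hy using hdvd
  refine ⟨y, mem_freeDegree.2 fun j c hc => ?_, funext fun j => (hy j).symm⟩
  have hshift : deg j + (Finsupp.single i 1 + c) = b :=
    mem_freeDegree.1 hx j _ (by rwa [hy j, coeff_X_mul])
  rw [← hshift, add_left_comm, add_tsub_cancel_left]

end FreeModules

section Syzygies

variable {k : Type*} [Field k] {m t : ℕ}

/-- A stage in the construction of a minimal resolution: a graded free module
`⨁_j k[v](-deg j)` with generators in squarefree degrees of total degree at least `t`, and the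
graded submodule `syz` of relations among the generators, which is contained in
`⟨v₁, …, v_m⟩ ⨁_j k[v](-deg j)`. Squarefreeness of `syz` is encoded as cancellation: `v_i x ∈ syz`
implies `x ∈ syz` when `x` is homogeneous of a degree involving `i`. -/
structure SquarefreeSyzygy (k : Type*) [Field k] (m t : ℕ) where
  rank : ℕ
  deg : Fin rank → (Fin m →₀ ℕ)
  deg_le_one : ∀ j i, deg j i ≤ 1
  le_degree : ∀ j, t ≤ (deg j).degree
  syz : Submodule (MvPolynomial (Fin m) k) (Fin rank → MvPolynomial (Fin m) k)
  le_iSup_inf : syz.restrictScalars k ≤ ⨆ b, syz.restrictScalars k ⊓ freeDegree k deg b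
  mem_of_X_smul_mem : ∀ i b, ∀ x ∈ freeDegree k deg b, b i ≠ 0 →
    (X i : MvPolynomial (Fin m) k) • x ∈ syz → x ∈ syz
  constantCoeff_eq_zero : ∀ x ∈ syz, ∀ j, constantCoeff (x j) = 0

namespace SquarefreeSyzygy

variable (Z : SquarefreeSyzygy k m t)

lemma rank_eq_zero_of_lt (ht : m < t) : Z.rank = 0 := by
  by_contra h
  let j : Fin Z.rank := ⟨0, Nat.pos_of_ne_zero h⟩
  have hle : (Z.deg j).degree ≤ m := by
    rw [Finsupp.degree_eq_sum]
    exact (Finset.sum_le_sum fun i _ => Z.deg_le_one j i).trans (by simp)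
  exact absurd ((Z.le_degree j).trans hle) (not_le.2 ht)

lemma lt_degree {a : Fin m →₀ ℕ} {x : Fin Z.rank → MvPolynomial (Fin m) k} (hx : x ∈ Z.syz)
    (hxa : x ∈ freeDegree k Z.deg a) (hne : x ≠ 0) : t < a.degree := by
  obtain ⟨j, hj⟩ := Function.ne_iff.1 hne
  obtain ⟨c, hc⟩ := MvPolynomial.ne_zero_iff.1 hj
  have hc0 : c.degree ≠ 0 := by
    rw [Ne, Finsupp.degree_eq_zero_iff]
    rintro rfl
    exact hc (Z.constantCoeff_eq_zero x hx j)
  have hle := Z.le_degree j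
  rw [← mem_freeDegree.1 hxa j c hc, map_add]
  omega

/-- The homogeneous elements of squarefree degree of `syz`. -/
def squarefreeElements : Set (Fin Z.rank → MvPolynomial (Fin m) k) :=
  {x | x ∈ Z.syz ∧ ∃ a : Fin m →₀ ℕ, (∀ i, a i ≤ 1) ∧ x ∈ freeDegree k Z.deg a}

lemma mem_span_squarefreeElements {b : Fin m →₀ ℕ} {x : Fin Z.rank → MvPolynomial (Fin m) k}
    (hx : x ∈ Z.syz) (hxb : x ∈ freeDegree k Z.deg b) :
    x ∈ Submodule.span (MvPolynomial (Fin m) k) Z.squarefreeElements := by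
  induction hn : b.degree generalizing b x with
  | zero =>
    rw [Finsupp.degree_eq_zero_iff] at hn
    exact Submodule.subset_span ⟨hx, b, by simp [hn], hxb⟩
  | succ n ih =>
    by_cases hsq : ∀ i, b i ≤ 1
    · exact Submodule.subset_span ⟨hx, b, hsq, hxb⟩
    push Not at hsq
    obtain ⟨i, hi⟩ := hsq
    obtain ⟨y, hyb, rfl⟩ := exists_X_smul_eq Z.deg_le_one hi hxb
    have hle : Finsupp.single i 1 ≤ b := Finsupp.single_le_iff.2 hi.le
    have hy : y ∈ Z.syz := by
      refine Z.mem_of_X_smul_mem i _ y hyb ?_ hx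
      rw [Finsupp.tsub_apply, Finsupp.single_eq_same]
      omega
    have hdegree : (b - Finsupp.single i 1).degree = n := by
      have h := congrArg Finsupp.degree (tsub_add_cancel_of_le hle)
      rw [map_add, Finsupp.degree_single, hn] at h
      omega
    exact Submodule.smul_mem _ _ (ih hy hyb hdegree)

lemma span_squarefreeElements :
    Submodule.span (MvPolynomial (Fin m) k) Z.squarefreeElements = Z.syz := by
  refine le_antisymm (Submodule.span_le.2 fun x hx => hx.1) ?_
  rw [← Submodule.restrictScalars_le k]
  exact Z.le_iSup_inf.trans (iSup_le fun b x hx => Z.mem_span_squarefreeElements hx.1 hx.2)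

lemma exists_irredundant_generators :
    ∃ (n : ℕ) (g : Fin n → Fin Z.rank → MvPolynomial (Fin m) k),
      (∀ j, g j ∈ Z.squarefreeElements) ∧
      Submodule.span (MvPolynomial (Fin m) k) (Set.range g) = Z.syz ∧
      ∀ j, g j ∉ Submodule.span (MvPolynomial (Fin m) k) (g '' {j}ᶜ) := by
  have h := exists_irredundant_fin_span_eq (R := MvPolynomial (Fin m) k)
    (S := Z.squarefreeElements) (IsNoetherian.noetherian _)
  rwa [span_squarefreeElements] at h

/-- The number of generators in a chosen irredundant system. -/
def genRank : ℕ :=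
  Z.exists_irredundant_generators.choose

/-- A chosen irredundant system of homogeneous generators of `syz` in squarefree degrees. -/
def gen : Fin Z.genRank → Fin Z.rank → MvPolynomial (Fin m) k :=
  Z.exists_irredundant_generators.choose_spec.choose

lemma gen_mem_squarefreeElements (j : Fin Z.genRank) : Z.gen j ∈ Z.squarefreeElements :=
  Z.exists_irredundant_generators.choose_spec.choose_spec.1 j

lemma span_range_gen : Submodule.span (MvPolynomial (Fin m) k) (Set.range Z.gen) = Z.syz :=
  Z.exists_irredundant_generators.choose_spec.choose_spec.2.1

lemma gen_notMem_span (j : Fin Z.genRank) :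
    Z.gen j ∉ Submodule.span (MvPolynomial (Fin m) k) (Z.gen '' {j}ᶜ) :=
  Z.exists_irredundant_generators.choose_spec.choose_spec.2.2 j

/-- The squarefree degree of a chosen generator of `syz`. -/
def genDeg (j : Fin Z.genRank) : Fin m →₀ ℕ :=
  (Z.gen_mem_squarefreeElements j).2.choose

lemma genDeg_le_one (j : Fin Z.genRank) : ∀ i, Z.genDeg j i ≤ 1 :=
  (Z.gen_mem_squarefreeElements j).2.choose_spec.1

lemma gen_mem_freeDegree (j : Fin Z.genRank) : Z.gen j ∈ freeDegree k Z.deg (Z.genDeg j) :=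
  (Z.gen_mem_squarefreeElements j).2.choose_spec.2

lemma lt_degree_genDeg (j : Fin Z.genRank) : t < (Z.genDeg j).degree := by
  refine Z.lt_degree (Z.gen_mem_squarefreeElements j).1 (Z.gen_mem_freeDegree j) fun h => ?_
  exact Z.gen_notMem_span j (h ▸ Submodule.zero_mem _)

/-- The minimal graded cover `⨁_j k[v](-genDeg j) → syz`. -/
def cover : (Fin Z.genRank → MvPolynomial (Fin m) k) →ₗ[MvPolynomial (Fin m) k]
    (Fin Z.rank → MvPolynomial (Fin m) k) :=
  Fintype.linearCombination (MvPolynomial (Fin m) k) Z.gen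

lemma cover_mem_freeDegree (b : Fin m →₀ ℕ) :
    ∀ x ∈ freeDegree k Z.genDeg b, Z.cover x ∈ freeDegree k Z.deg b :=
  fun _ => linearCombination_mem_freeDegree Z.gen_mem_freeDegree

lemma range_cover : LinearMap.range Z.cover = Z.syz := by
  rw [cover, Fintype.range_linearCombination, span_range_gen]

lemma exact_cover {M : Type*} [AddCommGroup M] [Module (MvPolynomial (Fin m) k) M]
    {φ : (Fin Z.rank → MvPolynomial (Fin m) k) →ₗ[MvPolynomial (Fin m) k] M}
    (hφ : LinearMap.ker φ = Z.syz) : Function.Exact Z.cover φ :=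
  LinearMap.exact_iff.2 (hφ.trans Z.range_cover.symm)

lemma ker_cover_le_iSup_inf : (LinearMap.ker Z.cover).restrictScalars k ≤
    ⨆ b, (LinearMap.ker Z.cover).restrictScalars k ⊓ freeDegree k Z.genDeg b :=
  ker_le_iSup_ker_inf (f := Z.cover.restrictScalars k) (iSup_freeDegree _)
    (iSupIndep_freeDegree Z.deg) Z.cover_mem_freeDegree

/-- By homogeneity a relation with a nonzero constant coefficient has a unit coefficient, which
would make the corresponding generator redundant. -/
lemma constantCoeff_eq_zero_of_mem_ker_cover {x : Fin Z.genRank → MvPolynomial (Fin m) k}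
    (hx : x ∈ LinearMap.ker Z.cover) (j : Fin Z.genRank) : constantCoeff (x j) = 0 := by
  refine Submodule.iSup_induction _ (motive := fun x => constantCoeff (x j) = 0)
    (Z.ker_cover_le_iSup_inf hx) (fun b y hy => ?_) (by simp) fun y z hy hz => by simp [hy, hz]
  by_contra hne
  have hunit : IsUnit (y j) := by
    rw [eq_C_of_mem_freeDegree hy.2 hne]
    exact (isUnit_iff_ne_zero.2 hne).map C
  have hrel : ∑ l, y l • Z.gen l = 0 := by
    rw [← Fintype.linearCombination_apply]
    exact hy.1
  exact not_isUnit_of_sum_smul_eq_zero hrel (Z.gen_notMem_span j) hunit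

/-- The relations among the chosen generators of `syz`. -/
def next : SquarefreeSyzygy k m (t + 1) where
  rank := Z.genRank
  deg := Z.genDeg
  deg_le_one := Z.genDeg_le_one
  le_degree := Z.lt_degree_genDeg
  syz := LinearMap.ker Z.cover
  le_iSup_inf := Z.ker_cover_le_iSup_inf
  mem_of_X_smul_mem i b x _ _ hx := by
    rw [LinearMap.mem_ker, map_smul] at hx
    exact (smul_eq_zero.1 hx).resolve_left (X_ne_zero i)
  constantCoeff_eq_zero _ := Z.constantCoeff_eq_zero_of_mem_ker_cover

/-- The `n`-fold syzygies. -/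
def iterate (Z : SquarefreeSyzygy k m 0) : ∀ n, SquarefreeSyzygy k m n
  | 0 => Z
  | n + 1 => (Z.iterate n).next

end SquarefreeSyzygy

end Syzygies

section StanleyReisner

variable {k : Type*} [Field k] {m : ℕ} {K : Finset (Finset (Fin m))}

lemma squarefreeVector_apply (a : Finset (Fin m)) (i : Fin m) :
    squarefreeVector a i = if i ∈ a then 1 else 0 := by
  simp [squarefreeVector, Finsupp.finsetSum_apply, Finsupp.single_apply]

lemma squarefreeVector_le_iff {a : Finset (Fin m)} {c : Fin m →₀ ℕ} :
    squarefreeVector a ≤ c ↔ a ⊆ c.support := by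
  simp only [Finsupp.le_def, squarefreeVector_apply, Finset.subset_iff, Finsupp.mem_support_iff]
  refine forall_congr' fun i => ?_
  split_ifs with h
  · simp [h, Nat.one_le_iff_ne_zero]
  · simp [h]

lemma support_squarefreeVector (a : Finset (Fin m)) : (squarefreeVector a).support = a := by
  ext i
  simp [squarefreeVector_apply]

lemma eq_squarefreeVector_support {a : Finset (Fin m)} {b : Fin m →₀ ℕ}
    (hb : b ≤ squarefreeVector a) : b = squarefreeVector b.support := by
  ext i
  have h := hb i
  rw [squarefreeVector_apply] at h ⊢
  simp only [Finsupp.mem_support_iff]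
  split_ifs at * <;> omega

lemma stanleyReisnerIdeal_eq_span_monomial (k : Type*) [Field k] (K : Finset (Finset (Fin m))) :
    stanleyReisnerIdeal k K =
      Ideal.span ((fun c => monomial c 1) '' (squarefreeVector '' {τ | τ ∉ K})) := by
  simp only [stanleyReisnerIdeal, Set.image_image, squarefreeVector, monomial_sum_one]
  congr 1
  ext p
  exact exists_congr fun τ => and_congr_right fun _ => eq_comm

lemma mem_stanleyReisnerIdeal (hK : IsSimplicialComplex K) {p : MvPolynomial (Fin m) k} :
    p ∈ stanleyReisnerIdeal k K ↔ ∀ c, coeff c p ≠ 0 → c.support ∉ K := by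
  simp only [stanleyReisnerIdeal_eq_span_monomial, mem_ideal_span_monomial_image, mem_support_iff,
    Set.exists_mem_image, squarefreeVector_le_iff]
  exact forall₂_congr fun c _ =>
    ⟨fun ⟨τ, hτ, hle⟩ hc => hτ (hK _ hc τ hle), fun hc => ⟨c.support, hc, subset_rfl⟩⟩

lemma mk_monomial_eq_zero_iff (hK : IsSimplicialComplex K) {b : Fin m →₀ ℕ} {u : k} :
    Ideal.Quotient.mk (stanleyReisnerIdeal k K) (monomial b u) = 0 ↔ u ≠ 0 → b.support ∉ K := by
  classical
  simp only [Ideal.Quotient.eq_zero_iff_mem, mem_stanleyReisnerIdeal hK, coeff_monomial, ne_eq,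
    ite_eq_right_iff, Classical.not_imp, and_imp, forall_eq']

lemma mem_faceRingDegree {b : Fin m →₀ ℕ} {x : faceRing k K} :
    x ∈ faceRingDegree k K b ↔
      ∃ u : k, Ideal.Quotient.mk (stanleyReisnerIdeal k K) (monomial b u) = x := by
  refine Submodule.mem_span_singleton.trans (exists_congr fun u => ?_)
  rw [← Ideal.Quotient.mkₐ_eq_mk k, ← map_smul, smul_monomial, smul_eq_mul, mul_one]

/-- The Stanley–Reisner ideal is spanned by monomials, so it contains every term of each of its
elements. -/
lemma iSupIndep_faceRingDegree (hK : IsSimplicialComplex K) :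
    iSupIndep (faceRingDegree k K) := by
  classical
  refine (iSupIndep_iff_finsetSum_eq_zero_imp_eq_zero _).2 fun s x hx hsum b hb => ?_
  choose! u hu using fun c hc => mem_faceRingDegree.1 (hx c hc)
  have hmem : ∑ c ∈ s, monomial c (u c) ∈ stanleyReisnerIdeal k K := by
    rw [← Ideal.Quotient.eq_zero_iff_mem, map_sum, Finset.sum_congr rfl hu, hsum]
  have hcoeff : coeff b (∑ c ∈ s, monomial c (u c)) = u b := by
    simp [coeff_sum, coeff_monomial, hb]
  rw [← hu b hb, mk_monomial_eq_zero_iff hK, ← hcoeff]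
  exact (mem_stanleyReisnerIdeal hK).1 hmem b

lemma finrank_faceRingDegree (hK : IsSimplicialComplex K) (b : Fin m →₀ ℕ) :
    Module.finrank k (faceRingDegree k K b) = if b.support ∈ K then 1 else 0 := by
  have hzero := mk_monomial_eq_zero_iff (k := k) hK (b := b) (u := 1)
  rw [imp_iff_right one_ne_zero] at hzero
  rw [faceRingDegree]
  split_ifs with h
  · exact finrank_span_singleton fun h0 => hzero.1 h0 h
  · rw [hzero.2 h, Submodule.span_zero_singleton, finrank_bot]

/-- The canonical projection `k[v] → k(K)`, with `k[v]` regarded as the free module `F₀` of rank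
one. -/
def augmentation (k : Type*) [Field k] (K : Finset (Finset (Fin m))) :
    (Fin 1 → MvPolynomial (Fin m) k) →ₗ[MvPolynomial (Fin m) k] faceRing k K :=
  (Submodule.mkQ (stanleyReisnerIdeal k K)).comp (LinearMap.proj 0)

lemma mem_ker_augmentation (hK : IsSimplicialComplex K) {x : Fin 1 → MvPolynomial (Fin m) k} :
    x ∈ LinearMap.ker (augmentation k K) ↔ ∀ c, coeff c (x 0) ≠ 0 → c.support ∉ K := by
  rw [← mem_stanleyReisnerIdeal hK, LinearMap.mem_ker, augmentation, LinearMap.comp_apply,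
    LinearMap.proj_apply, ← LinearMap.mem_ker, Submodule.ker_mkQ]

lemma augmentation_mem_faceRingDegree (K : Finset (Finset (Fin m))) (b : Fin m →₀ ℕ) :
    ∀ x ∈ freeDegree k (0 : Fin 1 → (Fin m →₀ ℕ)) b,
      augmentation k K x ∈ faceRingDegree k K b := by
  classical
  intro x hx
  have hmonomial : monomial b (coeff b (x 0)) = x 0 := by
    ext c
    rw [coeff_monomial]
    split_ifs with hbc
    · rw [hbc]
    · by_contra hc
      exact hbc (by simpa [eq_comm] using mem_freeDegree.1 hx 0 c (Ne.symm hc))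
  exact mem_faceRingDegree.2 ⟨_, congrArg (Ideal.Quotient.mk _) hmonomial⟩

/-- The Stanley–Reisner ideal as the first syzygy module of the face ring. -/
def idealSyzygy (k : Type*) [Field k] (hK : IsSimplicialComplex K) (h0 : ∅ ∈ K) :
    SquarefreeSyzygy k m 0 where
  rank := 1
  deg := 0
  deg_le_one := by simp
  le_degree := by simp
  syz := LinearMap.ker (augmentation k K)
  le_iSup_inf := ker_le_iSup_ker_inf (f := (augmentation k K).restrictScalars k)
    (iSup_freeDegree _) (iSupIndep_faceRingDegree hK) (augmentation_mem_faceRingDegree K)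
  mem_of_X_smul_mem i b x hxb hb hx := by
    rw [mem_ker_augmentation hK] at hx ⊢
    intro c hc
    have hcb : c = b := by simpa using mem_freeDegree.1 hxb 0 c hc
    have hsupp : (Finsupp.single i 1 + c).support = c.support := by
      ext l
      by_cases hl : l = i
      · simp [hl, hcb, hb]
      · simp [Ne.symm hl]
    rw [← hsupp]
    apply hx
    rwa [Pi.smul_apply, smul_eq_mul, coeff_X_mul]
  constantCoeff_eq_zero x hx j := by
    rw [mem_ker_augmentation hK] at hx
    by_contra h
    rw [Subsingleton.elim j 0] at h
    exact hx 0 h (by simpa using h0)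

theorem nonempty_minimalFreeResolution (k : Type*) [Field k] (hK : IsSimplicialComplex K)
    (h0 : ∅ ∈ K) : Nonempty (MinimalFreeResolution k K) := by
  let Z := (idealSyzygy k hK h0).iterate
  exact ⟨{
    length := Nat.findGreatest (fun n => (Z n).rank ≠ 0) m
    rank := fun n => (Z n).rank
    deg := fun n => (Z n).deg
    aug := augmentation k K
    d := fun n => (Z n).cover
    rank_length := Nat.findGreatest_spec (P := fun n => (Z n).rank ≠ 0) (Nat.zero_le m) one_ne_zero
    rank_eq_zero := fun i hi => by
      obtain him | hmi := le_or_gt i m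
      · exact not_not.1 (Nat.findGreatest_is_greatest hi him)
      · exact (Z i).rank_eq_zero_of_lt hmi
    aug_degree := augmentation_mem_faceRingDegree K
    d_degree := fun n => (Z n).cover_mem_freeDegree
    aug_surjective := (Submodule.mkQ_surjective _).comp (LinearMap.proj_surjective _)
    exact_zero := (Z 0).exact_cover (φ := augmentation k K) rfl
    exact_succ := fun i => (Z (i + 1)).exact_cover (φ := (Z i).cover) rfl
    minimal := fun i x =>
      (Z i).constantCoeff_eq_zero _ ((Z i).range_cover ▸ LinearMap.mem_range_self _ x) }⟩

end StanleyReisner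

section Mobius

variable {m : ℕ}

lemma natCast_card_Icc_finset {α : Type*} [DecidableEq α] (c a : Finset α) :
    ((Finset.Icc c a).card : ZMod 2) = if c = a then 1 else 0 := by
  split_ifs with h
  · simp [h]
  by_cases hca : c ⊆ a
  · have hlt := Finset.card_lt_card (hca.ssubset_of_ne h)
    rw [Finset.card_Icc_finset hca, Nat.cast_pow, ZMod.natCast_self,
      zero_pow (Nat.sub_ne_zero_of_lt hlt)]
  · rw [Finset.Icc_eq_empty hca, Finset.card_empty, Nat.cast_zero]

lemma mobius_mobius (f : Finset (Fin m) → ZMod 2) : mobius (mobius f) = f := by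
  funext a
  calc ∑ b ∈ a.powerset, ∑ c ∈ b.powerset, f c
      = ∑ c, ∑ _b ∈ Finset.Icc c a, f c :=
        Finset.sum_comm' fun b c => by simp [and_comm]
    _ = ∑ c, if c = a then f c else 0 := by
        simp only [Finset.sum_const, nsmul_eq_mul, natCast_card_Icc_finset, ite_mul, one_mul,
          zero_mul]
    _ = f a := by simp

lemma ite_mem_supp (f : Finset (Fin m) → ZMod 2) (a : Finset (Fin m)) :
    (if a ∈ supp f then 1 else 0) = f a := by
  have h : ∀ z : ZMod 2, (if z = 1 then 1 else 0) = z := by decide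
  simpa [supp] using h (f a)

lemma card_supp_natCast_le (g : Finset (Fin m) → ℕ) :
    (supp fun a => (g a : ZMod 2)).card ≤ ∑ a, g a := by
  rw [supp, Finset.card_filter]
  refine Finset.sum_le_sum fun a _ => ?_
  split_ifs with h
  · exact Nat.one_le_iff_ne_zero.2 fun h0 => by simp [h0] at h
  · exact Nat.zero_le _

end Mobius

namespace MinimalFreeResolution

variable {k : Type*} [Field k] {m : ℕ} {K : Finset (Finset (Fin m))}

theorem sum_neg_one_pow_card_deg_le (F : MinimalFreeResolution k K) (hK : IsSimplicialComplex K)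
    (b : Fin m →₀ ℕ) :
    ∑ i ∈ Finset.range (F.length + 1),
      (-1 : ℤ) ^ i * (Finset.univ.filter fun j => F.deg i j ≤ b).card =
        if b.support ∈ K then 1 else 0 := by
  have hindep := iSupIndep_faceRingDegree (k := k) hK
  have hempty : IsEmpty (Fin (F.rank (F.length + 1))) := by
    rw [F.rank_eq_zero _ F.length.lt_succ_self]
    infer_instance
  have heuler := sum_neg_one_pow_finrank_of_exact
    (V := fun i => freeDegree k (F.deg i) b)
    (d := fun i => ((F.d i).restrictScalars k).restrict (F.d_degree i b))
    (ε := (F.aug.restrictScalars k).restrict (F.aug_degree b))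
    (surjective_restrict (iSup_freeDegree _) hindep F.aug_degree F.aug_surjective b)
    (exact_restrict (iSup_freeDegree _) (iSupIndep_freeDegree _) (F.d_degree 0) F.aug_degree
      F.exact_zero b)
    (fun i => exact_restrict (iSup_freeDegree _) (iSupIndep_freeDegree _) (F.d_degree (i + 1))
      (F.d_degree i) (F.exact_succ i) b)
    F.length
  simpa only [finrank_freeDegree, finrank_faceRingDegree hK, Nat.cast_ite, Nat.cast_one,
    Nat.cast_zero] using heuler

lemma card_deg_le_squarefreeVector (F : MinimalFreeResolution k K) (i : ℕ) (a : Finset (Fin m)) :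
    (Finset.univ.filter fun j => F.deg i j ≤ squarefreeVector a).card =
      ∑ c ∈ a.powerset, F.betti i (squarefreeVector c) := by
  classical
  have hiff : ∀ {b : Fin m →₀ ℕ} {c : Finset (Fin m)}, c ⊆ a →
      (b ≤ squarefreeVector a ∧ b.support = c ↔ b = squarefreeVector c) := by
    intro b c hca
    constructor
    · rintro ⟨hb, rfl⟩
      exact eq_squarefreeVector_support hb
    · rintro rfl
      exact ⟨squarefreeVector_le_iff.2 (by rwa [support_squarefreeVector]),
        support_squarefreeVector c⟩
  rw [Finset.card_eq_sum_card_fiberwise (f := fun j => (F.deg i j).support) (t := a.powerset)]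
  · refine Finset.sum_congr rfl fun c hc => ?_
    simp only [Finset.filter_filter, hiff (Finset.mem_powerset.1 hc), betti]
  · intro j hj
    have hle : F.deg i j ≤ squarefreeVector a := (Finset.mem_filter.1 hj).2
    have hsupp := Finsupp.support_mono hle
    rw [support_squarefreeVector] at hsupp
    exact Finset.mem_coe.2 (Finset.mem_powerset.2 hsupp)

theorem sum_powerset_sum_neg_one_pow_betti (F : MinimalFreeResolution k K)
    (hK : IsSimplicialComplex K) (a : Finset (Fin m)) :
    ∑ c ∈ a.powerset, ∑ i ∈ Finset.range (F.length + 1),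
      (-1 : ℤ) ^ i * F.betti i (squarefreeVector c) = if a ∈ K then 1 else 0 := by
  have h := F.sum_neg_one_pow_card_deg_le hK (squarefreeVector a)
  simp only [card_deg_le_squarefreeVector, support_squarefreeVector, Nat.cast_sum,
    Finset.mul_sum] at h
  rw [Finset.sum_comm, h]

theorem mobius_eq_sum_betti {f : Finset (Fin m) → ZMod 2} (hf : IsNice f)
    (F : MinimalFreeResolution k (supp f)) :
    mobius f = fun a => ((∑ i ∈ Finset.range (F.length + 1),
      F.betti i (squarefreeVector a) : ℕ) : ZMod 2) := by
  rw [← mobius_mobius fun a => ((∑ i ∈ Finset.range (F.length + 1),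
    F.betti i (squarefreeVector a) : ℕ) : ZMod 2)]
  congr 1
  funext a
  have h := congrArg (Int.cast : ℤ → ZMod 2) (F.sum_powerset_sum_neg_one_pow_betti hf a)
  have hneg : (-1 : ZMod 2) = 1 := by decide
  push_cast [hneg, one_pow, one_mul, ite_mem_supp] at h
  rw [mobius, ← h]
  push_cast
  rfl

end MinimalFreeResolution

end FaceRing

end

theorem mainTheorem6_general (k : Type*) [Field k] (m : ℕ)
    (f : Finset (Fin m) → ZMod 2) (hf : FaceRing.IsNice f) (hne : (FaceRing.supp f).Nonempty) :
    Nonempty (FaceRing.MinimalFreeResolution k (FaceRing.supp f)) ∧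
      ∀ F : FaceRing.MinimalFreeResolution k (FaceRing.supp f),
        (FaceRing.supp (FaceRing.mobius f)).card ≤
          ∑ i ∈ Finset.range (F.length + 1), ∑ a : Finset (Fin m),
            F.betti i (FaceRing.squarefreeVector a) := by
  obtain ⟨a, ha⟩ := hne
  refine ⟨FaceRing.nonempty_minimalFreeResolution k hf (hf a ha ∅ a.empty_subset), fun F => ?_⟩
  rw [F.mobius_eq_sum_betti hf, Finset.sum_comm]
  exact FaceRing.card_supp_natCast_le _

theorem mainTheorem6 (k : Type*) [Field k] (m : ℕ) (hm : 0 < m)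
    (f : Finset (Fin m) → ZMod 2) (hf : FaceRing.IsNice f)
    (hV : FaceRing.vertexSet (FaceRing.supp f) = Finset.univ) :
    Nonempty (FaceRing.MinimalFreeResolution k (FaceRing.supp f)) ∧
      ∀ F : FaceRing.MinimalFreeResolution k (FaceRing.supp f),
        (FaceRing.supp (FaceRing.mobius f)).card ≤
          ∑ i ∈ Finset.range (F.length + 1), ∑ a : Finset (Fin m),
            F.betti i (FaceRing.squarefreeVector a) := by
  obtain ⟨a, ha, -⟩ := Finset.mem_biUnion.1 (hV ▸ Finset.mem_univ (⟨0, hm⟩ : Fin m))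
  exact mainTheorem6_general k m f hf ⟨a, ha⟩
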